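/- A multiplicative lattice is a commutative monoid $\mathcal L$ with a partial order making it a complete lattice, such that $x\bigvee S=\bigvee_{y\in S}xy$ for all $x\in\mathcal L$, $S\subseteq\mathcal L$, and such that the multiplicative identity $1$ is the top element; its bottom element is denoted $0$. It is a domain if $ab=0$ implies $a=0$ or $b=0$. It is a $C$-lattice if $1$ is compact, products of two compact elements are compact, and every element is a join of compact elements. Put $(y:x)=\bigvee\{a\in\mathcal L\mid ax\le y\}$ and $\sqrt x=\bigvee\{y\in\mathcal L\mid y^n\le x\text{ for some integer } n\ge 1\}$. An element $x$ is $\ell$-radical if $x=\sqrt x$, and $\ell$-principal if, for all $y,z\in\mathcal L$, $y\wedge zx=((y:x)\wedge z)x$ and $y\vee(z:x)=((yx\vee z):x)$. The lattice is principally generated if every element is a join of $\ell$-principal elements, and radical factorial if every element is a finite product of $\ell$-radical elements. Let $\mathcal L$ be a multiplicative lattice domain that is a $C$-lattice, principally generated and radical factorial. Then for every $x\in\mathcal L$ with $x\ne 0$ there are a unique integer $n\ge 0$ and a unique sequence $x_1\le x_2\le\cdots\le x_n$ of $\ell$-radical elements of $\mathcal L$, each different from $1$, such that $x=x_1x_2\cdots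 x_n$ (for $n=0$ the empty product is $1$). -/

import Mathlib

/-- A (commutative) multiplicative lattice: a commutative monoid on a complete lattice whose
multiplication distributes over arbitrary joins (`IsQuantale`) and whose multiplicative identity
is the top element. Its zero is the bottom element `⊥`. -/
class IsMultiplicativeLattice (L : Type*) [CommMonoid L] [CompleteLattice L] : Prop
    extends IsQuantale L where
  top_eq_one : (⊤ : L) = 1

namespace MultiplicativeLattice

variable (L : Type*) [CommMonoid L] [CompleteLattice L]

/-- A multiplicative lattice domain: a product is zero only if one of its factors is zero. -/
def IsLatticeDomain : Prop :=
  ∀ a b : L, a * b = ⊥ → a = ⊥ ∨ b = ⊥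

/-- A `C`-lattice: the compact elements are multiplicatively closed, contain `1`, and every
element is a join of compact elements. -/
structure IsCLattice : Prop where
  one_compact : IsCompactElement (1 : L)
  mul_compact : ∀ x y : L, IsCompactElement x → IsCompactElement y → IsCompactElement (x * y)
  exists_sSup_compact : ∀ x : L, ∃ S : Set L, (∀ y ∈ S, IsCompactElement y) ∧ x = sSup S

variable {L}

/-- The residual `(y : x)`, the join of all `a` with `a * x ≤ y`. -/
def lResidual (y x : L) : L := sSup {a : L | a * x ≤ y}

/-- The radical `√x`, the join of all elements some positive power of which lies below `x`. -/
def lRadical (x : L) : L := sSup {y : L | ∃ n : ℕ, 0 < n ∧ y ^ n ≤ x}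

/-- An element is `ℓ`-radical if it equals its radical. -/
def IsLRadical (x : L) : Prop := x = lRadical x

/-- Meet principal elements: `y ⊓ z x = ((y : x) ⊓ z) x` for all `y, z`. -/
def IsMeetPrincipal (x : L) : Prop :=
  ∀ y z : L, y ⊓ z * x = (lResidual y x ⊓ z) * x

/-- Join principal elements: `y ⊔ (z : x) = ((y x ⊔ z) : x)` for all `y, z`. -/
def IsJoinPrincipal (x : L) : Prop :=
  ∀ y z : L, y ⊔ lResidual z x = lResidual (y * x ⊔ z) x

/-- An element is `ℓ`-principal if it is both meet principal and join principal. -/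
def IsLPrincipal (x : L) : Prop := IsMeetPrincipal x ∧ IsJoinPrincipal x

variable (L)

/-- Every element is a join of `ℓ`-principal elements. -/
def IsPrincipallyGenerated : Prop :=
  ∀ x : L, ∃ S : Set L, (∀ y ∈ S, IsLPrincipal y) ∧ x = sSup S

/-- Every element is a finite product of `ℓ`-radical elements. -/
def IsRadicalFactorial : Prop :=
  ∀ x : L, ∃ l : List L, (∀ y ∈ l, IsLRadical y) ∧ l.prod = x

end MultiplicativeLattice

namespace MultiplicativeLattice

set_option linter.unusedSectionVars false

/-! ### Residuals, radicals, primes and localization. -/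

section Basic

variable {L : Type*} [CommMonoid L] [CompleteLattice L] [IsMultiplicativeLattice L]

open Quantale

/-! Locally at a nonzero prime `P`, a nonzero radical element looks like `P` or like `1`
(`prime_le_loc`). Checking locally, joins with a nonzero radical element are radical, `r * s = (r ⊓
s) * (r ⊔ s)`, and nonzero radical elements cancel. Replacing pairs by meet and join sorts any
radical factorization into a chain. The least factor of a chain is the radical of the product, so
cancelling it repeatedly gives uniqueness.

The local claim rests on dimension at most one (`le_of_prime_le_prime`). Given nonzero primes `p <
Q`, some prime `P` is locally minimal over `p ⊔ b`, with `b` principal, `b ≤ Q` and `b ≰ p`. If `P`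
is locally idempotent, Nakayama forces `b ≤ p`. Otherwise `P` is locally principal, which leaves no
room for a nonzero prime strictly below it. -/

theorem le_one (x : L) : x ≤ 1 :=
  (IsMultiplicativeLattice.top_eq_one (L := L)) ▸ le_top

theorem mul_le_left (x y : L) : x * y ≤ x := by
  simpa using mul_le_mul_right (le_one y) x

theorem mul_le_right (x y : L) : x * y ≤ y := by
  simpa using mul_le_mul_left (le_one x) y

theorem le_lResidual_iff {a x y : L} : a ≤ lResidual y x ↔ a * x ≤ y :=
  leftMulResiduation_le_iff_mul_le

theorem lResidual_mul_le (y x : L) : lResidual y x * x ≤ y :=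
  le_lResidual_iff.1 le_rfl

theorem lResidual_mono {y z : L} (h : y ≤ z) (x : L) : lResidual y x ≤ lResidual z x :=
  le_lResidual_iff.2 ((lResidual_mul_le y x).trans h)

theorem one_le_lResidual_iff {x y : L} : 1 ≤ lResidual y x ↔ x ≤ y := by
  rw [le_lResidual_iff, one_mul]

theorem IsMeetPrincipal.lResidual_mul_eq {b y : L} (hb : IsMeetPrincipal b) (h : y ≤ b) :
    lResidual y b * b = y := by
  have := hb y 1
  rw [one_mul, inf_eq_left.2 h, inf_eq_left.2 (le_one _)] at this
  exact this.symm

theorem sup_pow_add_le (a b : L) (m n : ℕ) : (a ⊔ b) ^ (m + n) ≤ a ^ m ⊔ b ^ n := by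
  induction m generalizing n with
  | zero => simpa using (le_one _).trans le_sup_left
  | succ m ihm =>
    induction n with
    | zero => simpa using (le_one _).trans le_sup_right
    | succ n ihn =>
      have h : m + 1 + (n + 1) = (m + 1 + n) + 1 := by ring
      have h' : m + 1 + n = m + (n + 1) := by ring
      rw [h, pow_succ, mul_sup_distrib]
      refine sup_le ?_ ?_
      · rw [h']
        refine (mul_le_mul_left (ihm (n + 1)) a).trans ?_
        rw [sup_mul_distrib, ← pow_succ]
        exact sup_le_sup_left (mul_le_left _ _) _
      · refine (mul_le_mul_left ihn b).trans ?_
        rw [sup_mul_distrib, ← pow_succ]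
        exact sup_le_sup_right (mul_le_left _ _) _

theorem le_lRadical (x : L) : x ≤ lRadical x :=
  le_sSup ⟨1, one_pos, by simp⟩

theorem IsLRadical.le_of_pow_le {r x : L} (hr : IsLRadical r) {n : ℕ} (h : x ^ n ≤ r) :
    x ≤ r := by
  rcases Nat.eq_zero_or_pos n with rfl | hn
  · exact (le_one x).trans (by simpa using h)
  · rw [hr]; exact le_sSup ⟨n, hn, h⟩

theorem isLRadical_of_forall {r : L} (h : ∀ (x : L) (n : ℕ), 0 < n → x ^ n ≤ r → x ≤ r) :
    IsLRadical r :=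
  le_antisymm (le_lRadical r) (sSup_le fun x ⟨n, hn, hx⟩ => h x n hn hx)

theorem IsLRadical.inf {r s : L} (hr : IsLRadical r) (hs : IsLRadical s) :
    IsLRadical (r ⊓ s) :=
  isLRadical_of_forall fun _ _ _ h =>
    le_inf (hr.le_of_pow_le (h.trans inf_le_left)) (hs.le_of_pow_le (h.trans inf_le_right))

theorem prod_le_of_mem {l : List L} {r : L} (h : r ∈ l) : l.prod ≤ r := by
  obtain ⟨w, hw⟩ := List.dvd_prod h
  rw [hw]; exact mul_le_left _ _

/-- Prime elements of a multiplicative lattice. -/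
structure IsPrimeElement (P : L) : Prop where
  ne_one : P ≠ 1
  le_or_le : ∀ a b : L, a * b ≤ P → a ≤ P ∨ b ≤ P

namespace IsPrimeElement

variable {P : L}

theorem not_one_le (hP : IsPrimeElement P) : ¬ 1 ≤ P := fun h => hP.ne_one ((le_one P).antisymm h)

theorem not_mul_le (hP : IsPrimeElement P) {a b : L} (ha : ¬ a ≤ P) (hb : ¬ b ≤ P) :
    ¬ a * b ≤ P :=
  fun h => (hP.le_or_le a b h).elim ha hb

theorem exists_mem_le_of_prod_le (hP : IsPrimeElement P) {l : List L} (h : l.prod ≤ P) :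
    ∃ r ∈ l, r ≤ P := by
  induction l with
  | nil => exact absurd (by simpa using h) hP.not_one_le
  | cons r l ih =>
    rw [List.prod_cons] at h
    rcases hP.le_or_le _ _ h with h | h
    · exact ⟨r, by simp, h⟩
    · obtain ⟨s, hs, hsP⟩ := ih h
      exact ⟨s, by simp [hs], hsP⟩

theorem le_of_pow_le (hP : IsPrimeElement P) {x : L} {n : ℕ} (h : x ^ n ≤ P) : x ≤ P := by
  induction n with
  | zero => exact absurd (by simpa using h) hP.not_one_le
  | succ n ih =>
    rw [pow_succ] at h
    exact (hP.le_or_le _ _ h).elim ih id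

end IsPrimeElement

/-- The closure of `y` under localization at `P`. -/
def loc (P y : L) : L := sSup {t : L | ∃ s, ¬ s ≤ P ∧ s * t ≤ y}

variable {P : L}

theorem le_loc_of_mul_le {s t y : L} (hs : ¬ s ≤ P) (h : s * t ≤ y) : t ≤ loc P y :=
  le_sSup ⟨s, hs, h⟩

theorem IsPrimeElement.le_loc (hP : IsPrimeElement P) (y : L) : y ≤ loc P y :=
  le_loc_of_mul_le hP.not_one_le (by simp)

theorem loc_mono {y z : L} (h : y ≤ z) : loc P y ≤ loc P z :=
  sSup_le_sSup fun _ ⟨s, hs, hst⟩ => ⟨s, hs, hst.trans h⟩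

theorem mul_loc_le (x y : L) : x * loc P y ≤ loc P (x * y) := by
  rw [loc, mul_sSup_distrib]
  refine iSup₂_le fun t ⟨s, hs, hst⟩ => le_loc_of_mul_le hs ?_
  rw [mul_left_comm]
  exact mul_le_mul_right hst x

theorem IsPrimeElement.loc_le {y p : L} (hp : IsPrimeElement p)
    (hpP : p ≤ P) (h : y ≤ p) : loc P y ≤ p :=
  sSup_le fun t ⟨s, hs, hst⟩ =>
    (hp.le_or_le s t (hst.trans h)).elim (fun hsp => absurd (hsp.trans hpP) hs) id

theorem loc_eq_one {y : L} (h : ¬ y ≤ P) : loc P y = 1 :=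
  (le_one _).antisymm (le_loc_of_mul_le h (by simp))

/-- Multiplying denominators makes the defining set directed, so compactness yields one denominator.
-/
theorem IsPrimeElement.exists_of_le_loc (hP : IsPrimeElement P) {t y : L}
    (ht : IsCompactElement t) (h : t ≤ loc P y) : ∃ s, ¬ s ≤ P ∧ s * t ≤ y := by
  obtain ⟨u, ⟨s, hs, hsu⟩, htu⟩ := ht {t : L | ∃ s, ¬ s ≤ P ∧ s * t ≤ y} _ ⟨y, 1, hP.not_one_le, by simp⟩ (by
    rintro t₁ ⟨s₁, hs₁, h₁⟩ t₂ ⟨s₂, hs₂, h₂⟩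
    refine ⟨t₁ ⊔ t₂, ⟨s₁ * s₂, hP.not_mul_le hs₁ hs₂, ?_⟩, le_sup_left, le_sup_right⟩
    rw [mul_sup_distrib]
    refine sup_le ?_ ?_
    · rw [mul_right_comm]; exact (mul_le_left _ _).trans h₁
    · rw [mul_assoc]; exact (mul_le_right _ _).trans h₂) (isLUB_sSup _) h
  exact ⟨s, hs, (mul_le_mul_right htu s).trans hsu⟩

end Basic

/-- Principally generated `C`-lattice domains. -/
structure IsPrincipalDomain (L : Type*) [CommMonoid L] [CompleteLattice L] : Prop where
  domain : IsLatticeDomain L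
  cLattice : IsCLattice L
  principal : IsPrincipallyGenerated L

/-! ### Principal elements, Nakayama, and existence of primes. -/

section PrincipalDomain

variable {L : Type*} [CommMonoid L] [CompleteLattice L] [IsMultiplicativeLattice L]

open Quantale

theorem IsPrincipalDomain.isCompactlyGenerated (hL : IsPrincipalDomain L) :
    IsCompactlyGenerated L where
  exists_sSup_eq x := by
    obtain ⟨S, hS, h⟩ := hL.cLattice.exists_sSup_compact x
    exact ⟨S, hS, h.symm⟩

theorem IsPrincipalDomain.le_of_mul_le_mul (hL : IsPrincipalDomain L) {b x y : L}
    (hb : IsLPrincipal b) (hb0 : b ≠ ⊥) (h : x * b ≤ y * b) : x ≤ y := by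
  have h0 : lResidual (⊥ : L) b = ⊥ :=
    (hL.domain _ _ (le_bot_iff.1 (lResidual_mul_le ⊥ b))).resolve_right hb0
  have := hb.2 y ⊥
  rw [h0, sup_bot_eq, sup_bot_eq] at this
  rw [this]
  exact le_lResidual_iff.2 h

/-- Dividing by `b` turns a cover of `b` into a cover of the compact element `1`. -/
theorem IsPrincipalDomain.isCompactElement (hL : IsPrincipalDomain L) {b : L}
    (hb : IsLPrincipal b) : IsCompactElement b := by
  have := hL.isCompactlyGenerated
  rcases eq_or_ne b ⊥ with rfl | hb0
  · rintro s u ⟨y, hy⟩ - - -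
    exact ⟨y, hy, bot_le⟩
  · intro D u hne hdir hu hbu
    rw [← hu.sSup_eq] at hbu
    have h1 : (1 : L) ≤ sSup ((fun d => lResidual d b) '' D) := by
      refine hL.le_of_mul_le_mul hb hb0 ?_
      rw [one_mul, sSup_mul_distrib, iSup_image]
      calc b = b ⊓ sSup D := (inf_eq_left.2 hbu).symm
        _ = ⨆ d ∈ D, b ⊓ d := hdir.inf_sSup_eq
        _ ≤ _ := iSup₂_mono fun d _ => by
          rw [← hb.1.lResidual_mul_eq (inf_le_left : b ⊓ d ≤ b)]
          exact mul_le_mul_left (lResidual_mono inf_le_right b) b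
    obtain ⟨_, ⟨d, hd, rfl⟩, h⟩ := hL.cLattice.one_compact _ _ (hne.image _) (by
      rintro _ ⟨d₁, h₁, rfl⟩ _ ⟨d₂, h₂, rfl⟩
      obtain ⟨d, hd, h₁', h₂'⟩ := hdir d₁ h₁ d₂ h₂
      exact ⟨_, ⟨d, hd, rfl⟩, lResidual_mono h₁' b, lResidual_mono h₂' b⟩) (isLUB_sSup _) h1
    exact ⟨d, hd, one_le_lResidual_iff.1 h⟩

theorem IsPrincipalDomain.exists_principal (hL : IsPrincipalDomain L) {x y : L} (h : ¬ x ≤ y) :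
    ∃ t, IsLPrincipal t ∧ t ≤ x ∧ ¬ t ≤ y := by
  by_contra! H
  obtain ⟨S, hS, rfl⟩ := hL.principal x
  exact h (sSup_le fun t ht => H t (hS t ht) (le_sSup ht))

theorem IsPrincipalDomain.le_of_forall_principal (hL : IsPrincipalDomain L) {x y : L}
    (h : ∀ t, IsLPrincipal t → t ≤ x → t ≤ y) : x ≤ y := by
  by_contra H
  obtain ⟨t, ht, htx, hty⟩ := hL.exists_principal H
  exact hty (h t ht htx)

variable {P : L}

theorem IsPrincipalDomain.loc_loc_le (hL : IsPrincipalDomain L) (hP : IsPrimeElement P) (y : L) :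
    loc P (loc P y) ≤ loc P y := by
  refine hL.le_of_forall_principal fun t ht h => ?_
  have htc := hL.isCompactElement ht
  obtain ⟨s, hs, hst⟩ := hP.exists_of_le_loc htc h
  obtain ⟨u, hu, hus, huP⟩ := hL.exists_principal hs
  obtain ⟨v, hv, hvu⟩ := hP.exists_of_le_loc
    (hL.cLattice.mul_compact u t (hL.isCompactElement hu) htc)
    ((mul_le_mul_left hus t).trans hst)
  exact le_loc_of_mul_le (hP.not_mul_le hv huP) (by rwa [mul_assoc])

theorem IsPrincipalDomain.loc_le_loc (hL : IsPrincipalDomain L) (hP : IsPrimeElement P) {x y : L}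
    (h : x ≤ loc P y) : loc P x ≤ loc P y :=
  (loc_mono h).trans (hL.loc_loc_le hP y)

theorem IsPrincipalDomain.mul_le_loc_mul (hL : IsPrincipalDomain L) (hP : IsPrimeElement P)
    {x x' y y' : L} (h : x ≤ loc P x') (h' : y ≤ loc P y') : x * y ≤ loc P (x' * y') := by
  refine (mul_le_mul' h h').trans ((mul_loc_le _ _).trans (hL.loc_le_loc hP ?_))
  rw [mul_comm, mul_comm x']
  exact mul_loc_le _ _

/-- A form of Nakayama's lemma for principal elements. -/
theorem IsPrincipalDomain.le_loc_of_le_loc_sup_sq (hL : IsPrincipalDomain L)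
    (hP : IsPrimeElement P) {b z : L} (hb : IsLPrincipal b) (hbP : b ≤ P)
    (h : b ≤ loc P (z ⊔ b * b)) : b ≤ loc P z := by
  obtain ⟨s, hs, hsb⟩ := hP.exists_of_le_loc (hL.isCompactElement hb) h
  -- Join principality gives `s ≤ b ⊔ (z : b)`, so `(z : b) ≤ P` would force `s ≤ P`.
  refine le_loc_of_mul_le (s := lResidual z b) (fun hz => hs ?_) (lResidual_mul_le z b)
  rw [sup_comm, ← le_lResidual_iff, ← hb.2] at hsb
  exact hsb.trans (sup_le hbP hz)

theorem IsPrincipalDomain.isCompactElement_pow (hL : IsPrincipalDomain L) {t : L}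
    (ht : IsCompactElement t) (n : ℕ) : IsCompactElement (t ^ n) := by
  induction n with
  | zero => simpa using hL.cLattice.one_compact
  | succ n ih => rw [pow_succ]; exact hL.cLattice.mul_compact _ _ ih ht

theorem IsPrincipalDomain.isPrimeElement_of_compact (hL : IsPrincipalDomain L) {Q : L}
    (h1 : Q ≠ 1) (h : ∀ a b : L, IsCompactElement a → IsCompactElement b → a * b ≤ Q →
      a ≤ Q ∨ b ≤ Q) : IsPrimeElement Q := by
  refine ⟨h1, fun a b hab => ?_⟩
  by_contra! H
  obtain ⟨t, ht, hta, htQ⟩ := hL.exists_principal H.1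
  obtain ⟨u, hu, hub, huQ⟩ := hL.exists_principal H.2
  exact (h t u (hL.isCompactElement ht) (hL.isCompactElement hu)
    ((mul_le_mul' hta hub).trans hab)).elim htQ huQ

/-- If no element of a submonoid `F₀` of compact elements lies below `x`, then there is a prime
element above `x`, not above any element of `F₀`, and locally minimal over `x`. -/
theorem IsPrincipalDomain.exists_prime (hL : IsPrincipalDomain L) (x : L) (F₀ : Submonoid L)
    (hc : ∀ s ∈ F₀, IsCompactElement s) (hx : ∀ s ∈ F₀, ¬ s ≤ x) :
    ∃ Q : L, IsPrimeElement Q ∧ x ≤ Q ∧ (∀ s ∈ F₀, ¬ s ≤ Q) ∧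
      ∀ t, IsCompactElement t → t ≤ Q → ∃ n : ℕ, t ^ n ≤ loc Q x := by
  obtain ⟨F, hF₀, hF⟩ := zorn_le_nonempty₀
    {F : Submonoid L | ∀ s ∈ F, IsCompactElement s ∧ ¬ s ≤ x} (by
      intro C hC hchain G hG
      refine ⟨sSup C, fun s hs => ?_, fun z hz => le_sSup hz⟩
      obtain ⟨H, hH, hsH⟩ := (Submonoid.mem_sSup_of_directedOn ⟨G, hG⟩ hchain.directedOn).1 hs
      exact hC hH s hsH) F₀ (fun s hs => ⟨hc s hs, hx s hs⟩)
  have hFc : ∀ s ∈ F, IsCompactElement s := fun s hs => (hF.prop s hs).1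
  have hFx : ∀ s ∈ F, ¬ s ≤ x := fun s hs => (hF.prop s hs).2
  -- `sSup T` is the required prime. By maximality of `F`, compact elements not below it lie in `F`;
  -- its definition gives local minimality.
  let T : Set L := {t | ∃ s ∈ F, ∃ n : ℕ, s * t ^ n ≤ x}
  have hcompact : ∀ t, IsCompactElement t → t ≤ sSup T → t ∈ T := by
    intro t ht h
    obtain ⟨u, ⟨s, hs, n, hsn⟩, htu⟩ := ht T _ ⟨x, 1, F.one_mem, 1, by simp⟩ (by
      rintro t₁ ⟨s₁, hs₁, n₁, h₁⟩ t₂ ⟨s₂, hs₂, n₂, h₂⟩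
      refine ⟨t₁ ⊔ t₂, ⟨s₁ * s₂, F.mul_mem hs₁ hs₂, n₁ + n₂, ?_⟩, le_sup_left, le_sup_right⟩
      refine (mul_le_mul_right (sup_pow_add_le t₁ t₂ n₁ n₂) _).trans ?_
      rw [mul_sup_distrib]
      refine sup_le ?_ ?_
      · rw [mul_right_comm]; exact (mul_le_left _ _).trans h₁
      · rw [mul_assoc]; exact (mul_le_right _ _).trans h₂) (isLUB_sSup _) h
    exact ⟨s, hs, n, (mul_le_mul_right (pow_le_pow_left' htu n) s).trans hsn⟩
  have hnot : ∀ s ∈ F, ¬ s ≤ sSup T := by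
    intro s hs h
    obtain ⟨u, hu, n, hun⟩ := hcompact s (hFc s hs) h
    exact hFx _ (F.mul_mem hu (F.pow_mem hs n)) hun
  have hmem : ∀ t, IsCompactElement t → ¬ t ≤ sSup T → t ∈ F := by
    intro t ht h
    have hle : F ⊔ Submonoid.powers t ≤ F := hF.le_of_ge (by
      intro s hs
      obtain ⟨y, hy, z, ⟨n, rfl⟩, rfl⟩ := Submonoid.mem_sup.1 hs
      exact ⟨hL.cLattice.mul_compact _ _ (hFc y hy) (hL.isCompactElement_pow ht n),
        fun hle => h (le_sSup ⟨y, hy, n, hle⟩)⟩) le_sup_left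
    exact hle (Submonoid.mem_sup_right (Submonoid.mem_powers t))
  refine ⟨sSup T, hL.isPrimeElement_of_compact ?_ ?_, ?_, fun s hs => hnot s (hF₀ hs), ?_⟩
  · intro h
    exact hnot 1 F.one_mem h.ge
  · intro a b ha hb hab
    by_contra! H
    exact hnot _ (F.mul_mem (hmem a ha H.1) (hmem b hb H.2)) hab
  · exact le_sSup ⟨1, F.one_mem, 1, by simp⟩
  · intro t ht h
    obtain ⟨s, hs, n, hsn⟩ := hcompact t ht h
    exact ⟨n, le_loc_of_mul_le (hnot s hs) hsn⟩

theorem IsPrincipalDomain.exists_prime_ge (hL : IsPrincipalDomain L) {x : L} (hx : x ≠ 1) :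
    ∃ Q : L, IsPrimeElement Q ∧ x ≤ Q ∧
      ∀ t, IsCompactElement t → t ≤ Q → ∃ n : ℕ, t ^ n ≤ loc Q x := by
  obtain ⟨Q, hQ, hxQ, -, h⟩ := hL.exists_prime x ⊥
    (fun s hs => by rw [Submonoid.mem_bot.1 hs]; exact hL.cLattice.one_compact)
    (fun s hs => by rw [Submonoid.mem_bot.1 hs]; exact fun h => hx ((le_one x).antisymm h))
  exact ⟨Q, hQ, hxQ, h⟩

end PrincipalDomain

/-! ### Local structure and dimension one. -/

section RadicalFactorial

variable {L : Type*} [CommMonoid L] [CompleteLattice L] [IsMultiplicativeLattice L] {P : L}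

open Quantale

/-- Either two factors lie below `P`, or exactly one does and the others are invertible locally. -/
theorem IsPrimeElement.prod_le_sq_or (hP : IsPrimeElement P) {l : List L} (h : l.prod ≤ P) :
    l.prod ≤ P * P ∨ ∃ r ∈ l, r ≤ loc P l.prod := by
  induction l with
  | nil => exact absurd (by simpa using h) hP.not_one_le
  | cons r l ih =>
    rw [List.prod_cons] at h ⊢
    by_cases hr : r ≤ P
    · by_cases hl : l.prod ≤ P
      · exact .inl (mul_le_mul' hr hl)
      · exact .inr ⟨r, by simp, le_loc_of_mul_le hl (by rw [mul_comm])⟩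
    · rcases ih ((hP.le_or_le _ _ h).resolve_left hr) with h' | ⟨s, hs, hsl⟩
      · exact .inl ((mul_le_right _ _).trans h')
      · refine .inr ⟨s, by simp [hs], ?_⟩
        exact hsl.trans (sSup_le fun t ⟨u, hu, hut⟩ =>
          le_loc_of_mul_le (hP.not_mul_le hr hu) (by
            rw [mul_assoc]; exact mul_le_mul_right hut r))

theorem IsPrincipalDomain.le_loc_prod (hL : IsPrincipalDomain L) (hP : IsPrimeElement P)
    (hPP : P ≤ loc P (P * P)) {l : List L} (h : ∀ r ∈ l, P ≤ loc P r) : P ≤ loc P l.prod := by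
  induction l with
  | nil => simpa using (le_one P).trans (hP.le_loc 1)
  | cons r l ih =>
    rw [List.prod_cons]
    refine hPP.trans (hL.loc_le_loc hP (hL.mul_le_loc_mul hP (h r (by simp)) (ih ?_)))
    exact fun s hs => h s (by simp [hs])

theorem IsPrincipalDomain.le_loc_of_pow_le_loc (hL : IsPrincipalDomain L)
    (hP : IsPrimeElement P) {r t : L} (hr : IsLRadical r) (ht : IsCompactElement t) {n : ℕ}
    (h : t ^ n ≤ loc P r) : t ≤ loc P r := by
  obtain ⟨s, hs, hst⟩ := hP.exists_of_le_loc (hL.isCompactElement_pow ht n) h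
  -- The exponent `n + 1` keeps a factor `s` even when `n = 0`.
  refine le_loc_of_mul_le hs (hr.le_of_pow_le (n := n + 1) ?_)
  rw [mul_pow, pow_succ' s, pow_succ t]
  exact (mul_le_mul' (mul_le_left _ _) (mul_le_left _ _)).trans hst

/-- For principal `b ≤ P`, `c ⊔ b * b` is not locally below `P * P`, so it is locally one radical
factor. That factor contains `b`, and Nakayama removes `b * b`. -/
theorem IsPrincipalDomain.le_loc_of_not_le_loc_sq (hL : IsPrincipalDomain L)
    (hF : IsRadicalFactorial L) (hP : IsPrimeElement P) {c : L} (hcP : c ≤ P)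
    (hc : ¬ c ≤ loc P (P * P)) : P ≤ loc P c := by
  refine hL.le_of_forall_principal fun b hb hbP => hL.le_loc_of_le_loc_sup_sq hP hb hbP ?_
  obtain ⟨l, hl, hprod⟩ := hF (c ⊔ b * b)
  have hle : l.prod ≤ P := hprod.le.trans (sup_le hcP ((mul_le_left b b).trans hbP))
  rcases hP.prod_le_sq_or hle with h | ⟨r, hr, hrl⟩
  · exact absurd ((le_sup_left.trans hprod.ge).trans (h.trans (hP.le_loc _))) hc
  · rw [hprod] at hrl
    refine le_trans ?_ hrl
    refine (hl r hr).le_of_pow_le (n := 2) ?_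
    rw [sq]
    exact (le_sup_right.trans hprod.ge).trans (prod_le_of_mem hr)

theorem IsPrincipalDomain.exists_isLRadical_mul (hL : IsPrincipalDomain L)
    (hF : IsRadicalFactorial L) (hP : IsPrimeElement P) (hP0 : P ≠ ⊥) :
    ∃ a r w : L, IsLPrincipal a ∧ a ≠ ⊥ ∧ IsLRadical r ∧ r ≤ P ∧ a = r * w := by
  obtain ⟨a, ha, haP, ha0⟩ := hL.exists_principal (x := P) (y := ⊥) (by rwa [le_bot_iff])
  obtain ⟨l, hl, rfl⟩ := hF a
  obtain ⟨r, hr, hrP⟩ := hP.exists_mem_le_of_prod_le haP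
  obtain ⟨w, hw⟩ := List.dvd_prod hr
  exact ⟨_, r, w, ha, fun h => ha0 h.le, hl r hr, hrP, hw⟩

/-- A locally principal prime has no nonzero primes strictly below it. -/
theorem IsPrincipalDomain.le_of_le_loc_principal (hL : IsPrincipalDomain L)
    (hF : IsRadicalFactorial L) (hP : IsPrimeElement P) {p c : L} (hp : IsPrimeElement p)
    (hp0 : p ≠ ⊥) (hpP : p ≤ P) (hc : IsLPrincipal c) (hcP : c ≤ P) (hPc : P ≤ loc P c) :
    P ≤ p := by
  by_contra hne
  have hcp : ¬ c ≤ p := fun h => hne (hPc.trans (hp.loc_le hpP h))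
  obtain ⟨a, r, w, ha, ha0, hr, hrp, rfl⟩ := hL.exists_isLRadical_mul hF hp hp0
  -- Put `y = (r : c)`. Locally `y ≤ c`, so `y * y ≤ y * c ≤ r`, and `r` is radical.
  have hy : lResidual r c ≤ loc P r := by
    have hyp : lResidual r c ≤ P :=
      ((hp.le_or_le _ _ ((lResidual_mul_le r c).trans hrp)).resolve_right hcp).trans hpP
    refine hL.le_of_forall_principal fun t ht hty => ?_
    obtain ⟨s, hs, hst⟩ := hP.exists_of_le_loc (hL.isCompactElement ht) (hty.trans (hyp.trans hPc))
    refine le_loc_of_mul_le hs (hr.le_of_pow_le (n := 2) ?_)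
    rw [sq]
    exact (mul_le_mul' ((mul_le_right s t).trans hty) hst).trans (lResidual_mul_le r c)
  have hrc : r ≤ loc P (c * r) := by
    refine hL.le_of_forall_principal fun t ht htr => ?_
    obtain ⟨s, hs, hst⟩ := hP.exists_of_le_loc (hL.isCompactElement ht)
      (htr.trans (hrp.trans (hpP.trans hPc)))
    refine (le_loc_of_mul_le hs ?_).trans (hL.loc_loc_le hP _)
    rw [← hc.1.lResidual_mul_eq hst, mul_comm]
    exact (mul_le_mul_right ((lResidual_mono ((mul_le_right s t).trans htr) c).trans hy) c).trans
      (mul_loc_le _ _)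
  have hac : r * w ≤ loc P (c * (r * w)) := by
    rw [← mul_assoc, mul_comm r w, mul_comm (c * r) w]
    exact (mul_le_mul_right hrc w).trans (mul_loc_le _ _)
  obtain ⟨s, hs, hsa⟩ := hP.exists_of_le_loc (hL.isCompactElement ha) hac
  exact hs ((hL.le_of_mul_le_mul ha ha0 hsa).trans hcP)

/-- The lattice has dimension at most one. -/
theorem IsPrincipalDomain.le_of_prime_le_prime (hL : IsPrincipalDomain L)
    (hF : IsRadicalFactorial L) {p Q : L} (hp : IsPrimeElement p) (hp0 : p ≠ ⊥)
    (hQ : IsPrimeElement Q) : p ≤ Q → Q ≤ p := by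
  intro hpQ
  by_contra hne
  obtain ⟨b, hb, hbQ, hbp⟩ := hL.exists_principal hne
  obtain ⟨P, hP, hle, hmin⟩ := hL.exists_prime_ge (x := p ⊔ b)
    (fun h => hQ.not_one_le (h.ge.trans (sup_le hpQ hbQ)))
  have hpP : p ≤ P := le_sup_left.trans hle
  have hbP : b ≤ P := le_sup_right.trans hle
  -- If `P` is locally idempotent, then locally `b ≤ P * P ≤ (p ⊔ b) * (p ⊔ b) ≤ p ⊔ b * b`.
  by_cases hPP : P ≤ loc P (P * P)
  · have hPx : P ≤ loc P (p ⊔ b) := by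
      obtain ⟨l, hl, hprod⟩ := hF (p ⊔ b)
      rw [← hprod]
      refine hL.le_loc_prod hP hPP fun r hr => hL.le_of_forall_principal fun t ht htP => ?_
      obtain ⟨n, hn⟩ := hmin t (hL.isCompactElement ht) htP
      exact hL.le_loc_of_pow_le_loc hP (hl r hr) (hL.isCompactElement ht)
        (hn.trans (loc_mono (hprod.ge.trans (prod_le_of_mem hr))))
    have hsq : b ≤ loc P (p ⊔ b * b) := by
      refine (hbP.trans hPP).trans ((hL.loc_le_loc hP (hL.mul_le_loc_mul hP hPx hPx)).trans
        (loc_mono ?_))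
      rw [mul_sup_distrib, sup_mul_distrib (z := b)]
      exact sup_le ((mul_le_right _ _).trans le_sup_left)
        (sup_le ((mul_le_left _ _).trans le_sup_left) le_sup_right)
    exact hbp ((hL.le_loc_of_le_loc_sup_sq hP hb hbP hsq).trans (hp.loc_le hpP le_rfl))
  · obtain ⟨c, hc, hcP, hcPP⟩ := hL.exists_principal hPP
    exact hbp (hbP.trans (hL.le_of_le_loc_principal hF hP hp hp0 hpP hc hcP
      (hL.le_loc_of_not_le_loc_sq hF hP hcP hcPP)))

/-- A nonzero radical element agrees with `P` or with `1` locally at a nonzero prime `P`. -/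
theorem IsPrincipalDomain.prime_le_loc (hL : IsPrincipalDomain L)
    (hF : IsRadicalFactorial L) (hP : IsPrimeElement P) {r : L} (hr : IsLRadical r)
    (hr0 : r ≠ ⊥) : P ≤ loc P r := by
  by_cases hrP : r ≤ P
  swap
  · rw [loc_eq_one hrP]; exact le_one P
  -- Avoiding these elements keeps the new prime below `P`; dimension one then makes it equal to
  -- `P`.
  let F₀ : Submonoid L :=
    { carrier := {s | IsCompactElement s ∧ ¬ s ≤ P}
      one_mem' := ⟨hL.cLattice.one_compact, hP.not_one_le⟩
      mul_mem' := fun ha hb =>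
        ⟨hL.cLattice.mul_compact _ _ ha.1 hb.1, hP.not_mul_le ha.2 hb.2⟩ }
  obtain ⟨Q, hQ, hrQ, hQF, hmin⟩ := hL.exists_prime r F₀ (fun s hs => hs.1)
    (fun s hs h => hs.2 (h.trans hrP))
  have hQP : Q ≤ P := hL.le_of_forall_principal fun t ht htQ => by
    by_contra h
    exact hQF t ⟨hL.isCompactElement ht, h⟩ htQ
  obtain rfl : Q = P := hQP.antisymm (hL.le_of_prime_le_prime hF hQ
    (fun h => hr0 (le_bot_iff.1 (h ▸ hrQ))) hP hQP)
  refine hL.le_of_forall_principal fun t ht htQ => ?_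
  obtain ⟨n, hn⟩ := hmin t (hL.isCompactElement ht) htQ
  exact hL.le_loc_of_pow_le_loc hP hr (hL.isCompactElement ht) hn

/-! ### Local-to-global consequences and chains. -/

theorem IsPrincipalDomain.le_of_forall_loc (hL : IsPrincipalDomain L) {x y : L} (hy : y ≠ ⊥)
    (h : ∀ P : L, IsPrimeElement P → P ≠ ⊥ → x ≤ loc P y) : x ≤ y := by
  refine hL.le_of_forall_principal fun t ht htx => ?_
  by_contra hty
  obtain ⟨P, hP, hle, -⟩ := hL.exists_prime_ge (x := lResidual y t)
    (fun h => hty (one_le_lResidual_iff.1 h.ge))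
  have hyP : y ≤ P := le_trans (le_lResidual_iff.2 (mul_le_left y t)) hle
  obtain ⟨s, hs, hst⟩ := hP.exists_of_le_loc (hL.isCompactElement ht)
    (htx.trans (h P hP fun h => hy (le_bot_iff.1 (h ▸ hyP))))
  exact hs ((le_lResidual_iff.2 hst).trans hle)

theorem IsPrincipalDomain.le_of_isLRadical_mul_le_mul (hL : IsPrincipalDomain L)
    (hF : IsRadicalFactorial L) {r x y : L} (hr : IsLRadical r) (hr0 : r ≠ ⊥)
    (h : r * x ≤ r * y) : x ≤ y := by
  rcases eq_or_ne y ⊥ with rfl | hy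
  · rw [mul_bot, le_bot_iff] at h
    exact ((hL.domain _ _ h).resolve_left hr0).le
  refine hL.le_of_forall_loc hy fun P hP hP0 => ?_
  by_cases hrP : r ≤ P
  swap
  · exact le_loc_of_mul_le hrP (h.trans (mul_le_right _ _))
  -- Locally `r` agrees with the radical element `b`, which cancels because it divides a nonzero
  -- principal element.
  obtain ⟨a, b, w, ha, ha0, hb, hbP, rfl⟩ := hL.exists_isLRadical_mul hF hP hP0
  have hb0 : b ≠ ⊥ := fun h => ha0 (by rw [h, bot_mul])
  have h1 : b * x ≤ loc P (b * y) := by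
    refine (hL.mul_le_loc_mul hP (hbP.trans (hL.prime_le_loc hF hP hr hr0)) (hP.le_loc x)).trans
      (hL.loc_le_loc hP (h.trans ?_))
    exact hL.mul_le_loc_mul hP (hrP.trans (hL.prime_le_loc hF hP hb hb0)) (hP.le_loc y)
  refine hL.le_of_forall_principal fun t ht htx => ?_
  have h2 : b * w * t ≤ loc P (b * w * y) := by
    rw [mul_right_comm, mul_right_comm b w y, mul_comm _ w, mul_comm _ w]
    exact (mul_le_mul_right ((mul_le_mul_right htx b).trans h1) w).trans (mul_loc_le _ _)
  obtain ⟨s, hs, hst⟩ := hP.exists_of_le_loc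
    (hL.cLattice.mul_compact _ _ (hL.isCompactElement ha) (hL.isCompactElement ht)) h2
  refine le_loc_of_mul_le hs (hL.le_of_mul_le_mul ha ha0 ?_)
  rwa [mul_assoc, mul_comm t, mul_comm y]

theorem IsPrincipalDomain.isLRadical_sup (hL : IsPrincipalDomain L)
    (hF : IsRadicalFactorial L) {r : L} (hr : IsLRadical r) (hr0 : r ≠ ⊥) (s : L) :
    IsLRadical (r ⊔ s) := by
  refine isLRadical_of_forall fun x n _ hx => hL.le_of_forall_loc
    (fun h => hr0 (sup_eq_bot_iff.1 h).1) fun P hP _ => ?_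
  by_cases h : r ⊔ s ≤ P
  · exact (hP.le_of_pow_le (hx.trans h)).trans
      ((hL.prime_le_loc hF hP hr hr0).trans (loc_mono le_sup_left))
  · rw [loc_eq_one h]; exact le_one x

theorem IsPrincipalDomain.inf_mul_sup_eq (hL : IsPrincipalDomain L)
    (hF : IsRadicalFactorial L) {r s : L} (hr : IsLRadical r) (hr0 : r ≠ ⊥)
    (hs : IsLRadical s) (hs0 : s ≠ ⊥) : (r ⊓ s) * (r ⊔ s) = r * s := by
  have hrs : r * s ≤ r ⊓ s := le_inf (mul_le_left r s) (mul_le_right r s)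
  have hinf : r ⊓ s ≠ ⊥ := fun h =>
    (hL.domain r s (le_bot_iff.1 (h ▸ hrs))).elim hr0 hs0
  apply le_antisymm
  · rw [mul_sup_distrib]
    refine sup_le ?_ (mul_le_mul_left inf_le_left s)
    rw [mul_comm r s]
    exact mul_le_mul_left inf_le_right r
  · refine hL.le_of_forall_loc
      (fun h => (hL.domain _ _ h).elim hinf fun h => hr0 (sup_eq_bot_iff.1 h).1)
      fun P hP _ => ?_
    by_cases h : r ⊔ s ≤ P
    · exact hL.mul_le_loc_mul hP
        ((le_sup_left.trans h).trans (hL.prime_le_loc hF hP (hr.inf hs) hinf))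
        (le_sup_right.trans (hP.le_loc _))
    · refine le_loc_of_mul_le h ?_
      rw [mul_comm (r ⊓ s)]
      exact mul_le_mul_right hrs _

/-- `r ⊓ x` becomes the head and `r ⊔ x` is inserted into the tail. The lower-bound clause carries
the chain condition through the induction. -/
theorem IsPrincipalDomain.exists_insert_chain (hL : IsPrincipalDomain L)
    (hF : IsRadicalFactorial L) {l : List L} (hl : ∀ y ∈ l, y ≠ ⊥ ∧ IsLRadical y)
    (hchain : l.Pairwise (· ≤ ·)) {r : L} (hr : IsLRadical r) (hr0 : r ≠ ⊥) :
    ∃ l' : List L, (∀ y ∈ l', y ≠ ⊥ ∧ IsLRadical y) ∧ l'.Pairwise (· ≤ ·) ∧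
      l'.prod = r * l.prod ∧ ∀ z, z ≤ r → (∀ y ∈ l, z ≤ y) → ∀ y ∈ l', z ≤ y := by
  induction l generalizing r with
  | nil => exact ⟨[r], by simp [hr, hr0], by simp, by simp, by simp +contextual⟩
  | cons x l ih =>
    rw [List.forall_mem_cons] at hl
    rw [List.pairwise_cons] at hchain
    obtain ⟨⟨hx0, hx⟩, hl⟩ := hl
    obtain ⟨l', hl', hc', hprod, hlow⟩ := ih hl hchain.2
      (hL.isLRadical_sup hF hr hr0 x) fun h => hr0 (sup_eq_bot_iff.1 h).1
    have hmul := hL.inf_mul_sup_eq hF hr hr0 hx hx0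
    refine ⟨(r ⊓ x) :: l', ?_, ?_, ?_, ?_⟩
    · rw [List.forall_mem_cons]
      refine ⟨⟨fun h => ?_, hr.inf hx⟩, hl'⟩
      rw [h, bot_mul] at hmul
      exact (hL.domain r x hmul.symm).elim hr0 hx0
    · rw [List.pairwise_cons]
      exact ⟨hlow _ (inf_le_left.trans le_sup_left)
        fun y hy => inf_le_right.trans (hchain.1 y hy), hc'⟩
    · rw [List.prod_cons, List.prod_cons, hprod, ← mul_assoc, hmul, mul_assoc]
    · intro z hz hzl
      rw [List.forall_mem_cons] at hzl ⊢
      exact ⟨le_inf hz hzl.1, hlow z (hz.trans le_sup_left) hzl.2⟩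

theorem IsPrincipalDomain.exists_chain (hL : IsPrincipalDomain L)
    (hF : IsRadicalFactorial L) {l : List L} (hl : ∀ y ∈ l, y ≠ ⊥ ∧ IsLRadical y) :
    ∃ l' : List L, (∀ y ∈ l', y ≠ ⊥ ∧ IsLRadical y) ∧ l'.Pairwise (· ≤ ·) ∧
      l'.prod = l.prod := by
  induction l with
  | nil => exact ⟨[], by simp, by simp, rfl⟩
  | cons r l ih =>
    rw [List.forall_mem_cons] at hl
    obtain ⟨l₁, h₁, hc₁, hp₁⟩ := ih hl.2
    obtain ⟨l₂, h₂, hc₂, hp₂, -⟩ := hL.exists_insert_chain hF h₁ hc₁ hl.1.2 hl.1.1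
    exact ⟨l₂, h₂, hc₂, by rw [hp₂, hp₁, List.prod_cons]⟩

theorem exists_sublist_prod_eq {M : Type*} [Monoid M] (l : List M) :
    ∃ l' : List M, l'.Sublist l ∧ (∀ y ∈ l', y ≠ 1) ∧ l'.prod = l.prod := by
  induction l with
  | nil => exact ⟨[], by simp, by simp, rfl⟩
  | cons r l ih =>
    obtain ⟨l', hs, h1, hp⟩ := ih
    by_cases hr : r = 1
    · exact ⟨l', hs.cons r, h1, by simp [hp, hr]⟩
    · exact ⟨r :: l', hs.cons_cons r, by simpa [hr] using h1, by simp [hp]⟩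

/-- A power of the least factor `a` lies below the product, hence below `b`. -/
theorem head_le_of_prod_eq {a b : L} {l m : List L} (hl : (a :: l).Pairwise (· ≤ ·))
    (hb : IsLRadical b) (h : (a :: l).prod = (b :: m).prod) : a ≤ b := by
  refine hb.le_of_pow_le (n := (a :: l).length) ((List.pow_card_le_prod _ _ ?_).trans
    (h.le.trans (prod_le_of_mem (by simp))))
  rw [List.forall_mem_cons]
  exact ⟨le_rfl, (List.pairwise_cons.1 hl).1⟩

theorem IsPrincipalDomain.chain_unique (hL : IsPrincipalDomain L) (hF : IsRadicalFactorial L)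
    {l m : List L} (hl : ∀ y ∈ l, y ≠ 1 ∧ IsLRadical y) (hm : ∀ y ∈ m, y ≠ 1 ∧ IsLRadical y)
    (hlc : l.Pairwise (· ≤ ·)) (hmc : m.Pairwise (· ≤ ·)) (h : l.prod = m.prod)
    (h0 : l.prod ≠ ⊥) : l = m := by
  have key : ∀ (a : L) (k : List L), (∀ y ∈ a :: k, y ≠ 1 ∧ IsLRadical y) →
      (a :: k).prod ≠ 1 := fun a k hk h =>
    (hk a (by simp)).1 ((le_one a).antisymm (h.ge.trans (prod_le_of_mem (by simp))))
  induction l generalizing m with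
  | nil =>
    cases m with
    | nil => rfl
    | cons b m => exact absurd h.symm (key b m hm)
  | cons a l ih =>
    cases m with
    | nil => exact absurd h (key a l hl)
    | cons b m =>
      obtain rfl : a = b := (head_le_of_prod_eq hlc (hm b (by simp)).2 h).antisymm
        (head_le_of_prod_eq hmc (hl a (by simp)).2 h.symm)
      rw [List.prod_cons] at h0
      have ha0 : a ≠ ⊥ := fun h => h0 (by rw [h, bot_mul])
      have ha : IsLRadical a := (hl a (by simp)).2
      rw [List.prod_cons, List.prod_cons] at h
      rw [ih (fun y hy => hl y (by simp [hy])) (fun y hy => hm y (by simp [hy]))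
        (List.pairwise_cons.1 hlc).2 (List.pairwise_cons.1 hmc).2
        ((hL.le_of_isLRadical_mul_le_mul hF ha ha0 h.le).antisymm
          (hL.le_of_isLRadical_mul_le_mul hF ha ha0 h.ge))
        (fun h => h0 (by rw [h, mul_bot]))]

end RadicalFactorial

end MultiplicativeLattice

theorem corollary6p7 {L : Type*} [CommMonoid L] [CompleteLattice L] [IsMultiplicativeLattice L]
    (hdomain : MultiplicativeLattice.IsLatticeDomain L)
    (hC : MultiplicativeLattice.IsCLattice L)
    (hprin : MultiplicativeLattice.IsPrincipallyGenerated L)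
    (hrad : MultiplicativeLattice.IsRadicalFactorial L)
    (x : L) (hx : x ≠ ⊥) :
    ∃! l : List L,
      (∀ y ∈ l, y ≠ 1 ∧ MultiplicativeLattice.IsLRadical y) ∧
        l.Pairwise (· ≤ ·) ∧ l.prod = x := by
  have hL : MultiplicativeLattice.IsPrincipalDomain L := ⟨hdomain, hC, hprin⟩
  obtain ⟨l₀, h₀, hp₀⟩ := hrad x
  obtain ⟨l₁, h₁, hc₁, hp₁⟩ := hL.exists_chain hrad (l := l₀) fun y hy =>
    ⟨fun h => hx (le_bot_iff.1 (hp₀ ▸ h ▸ MultiplicativeLattice.prod_le_of_mem hy)), h₀ y hy⟩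
  obtain ⟨l, hs, hne, hp⟩ := MultiplicativeLattice.exists_sublist_prod_eq l₁
  refine ⟨l, ⟨fun y hy => ⟨hne y hy, (h₁ y (hs.subset hy)).2⟩, hc₁.sublist hs,
    hp.trans (hp₁.trans hp₀)⟩, ?_⟩
  rintro m ⟨hm, hmc, rfl⟩
  exact hL.chain_unique hrad hm (fun y hy => ⟨hne y hy, (h₁ y (hs.subset hy)).2⟩) hmc
    (hc₁.sublist hs) (hp.trans (hp₁.trans hp₀)).symm hx
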